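/- For $\nu,m\in\mathbb{C}$ and real $x>-1$, $x\neq 1$, let $$P_\nu^{m}(x)=\left|\frac{1-x}{1+x}\right|^{-m/2}\frac{F\left(-\nu,\nu+1;1-m;\frac{1-x}{2}\right)}{\Gamma(1-m)},$$ which is the Ferrers function of the first kind for $-1<x<1$ and the associated Legendre function of the first kind for $x>1$. Here $F(a,b;c;t)$, $t<1$, is the Gauss hypergeometric function (for $t\le -1$ its analytic continuation along the negative real axis), and the quotient $F(a,b;c;t)/\Gamma(c)$ is understood as an entire function of $a,b,c$. Let $(a)_n=a(a+1)\cdots(a+n-1)$, $(a)_0=1$, and let $g_n(\sigma)$ be the Mittag-Leffler polynomials: $g_0(\sigma)=1$, $g_n(\sigma)=2\sigma F(1-n,1-\sigma;2;2)$ for $n\ge 1$, so that $\left(\frac{1+z}{1-z}\right)^{\sigma}=\sum_{n=0}^\infty g_n(\sigma)z^n$ for $|z|<1$. Then for all $x\in(0,1)$ and all $\mu,\nu\in\mathbb{C}$ the following two series converge absolutely and $$\frac{P_\nu^{-\mu}(x)}{x^{\nu}}=\sum_{n=0}^{\infty}(\mu-\nu)_n\,g_n(\nu)\left(\frac{1-x}{1+x}\right)^{n/2}P_\nu^{-n-\mu}\left(\frac1x\right),$$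 $$P_\nu^{-\mu}\left(\frac1x\right)=\sum_{n=0}^{\infty}(\mu-\nu)_n\,g_n(-\nu)\left(\frac{1-x}{1+x}\right)^{n/2}\frac{P_\nu^{-n-\mu}(x)}{x^{\nu}}.$$ The two series are mutually inverse: with $a_n^{\pm}(\mu)=(\mu-\nu)_n\,g_n(\pm\nu)\left(\frac{1-x}{1+x}\right)^{n/2}$ one has, for every $N\in\mathbb{N}_0$, $$\sum_{n=0}^{N}a_n^{+}(\mu)\,a_{N-n}^{-}(\mu+n)=\sum_{n=0}^{N}a_n^{-}(\mu)\,a_{N-n}^{+}(\mu+n)=\delta_{N,0}.$$ -/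

import Mathlib

noncomputable section

/-- Olver's regularized Gauss function `F(a,b;c;t)/Γ(c)` for real `t < 1`, entire in `a`, `b`, `c`.
For `-1 < t < 1` it is the sum of `∑ (a)ₙ(b)ₙ/(n! Γ(c+n)) tⁿ`; for `t ≤ -1` it is the analytic
continuation of that sum along the negative real axis, which the Pfaff transformation
`F(a,b;c;t) = (1-t)^(-a) F(a,c-b;c;t/(t-1))` expresses by a convergent series. -/
def gaussReg (a b c : ℂ) (t : ℝ) : ℂ :=
  if -1 < t then
    Complex.regularizedGaussHGFun a b c (t : ℂ)
  else
    ((1 - t : ℝ) : ℂ) ^ (-a) *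
      Complex.regularizedGaussHGFun a (c - b) c ((t / (t - 1) : ℝ) : ℂ)

/-- `P_ν^m(x)` (index `ν`, order `m`, the superscript) for real `x > -1`:
`P_ν^m(x) = |(1-x)/(1+x)|^(-m/2) F(-ν, ν+1; 1-m; (1-x)/2) / Γ(1-m)`.
It is the Ferrers function of the first kind for `-1 < x < 1` and the associated Legendre function
of the first kind for `x > 1`. -/
def legendreP (ν m : ℂ) (x : ℝ) : ℂ :=
  ((|(1 - x) / (1 + x)| : ℝ) : ℂ) ^ (-m / 2) * gaussReg (-ν) (ν + 1) (1 - m) ((1 - x) / 2)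

/-- Mittag-Leffler polynomials: `g₀(σ) = 1`, `gₙ(σ) = 2σ F(1-n, 1-σ; 2; 2)` for `n ≥ 1`
(a terminating series); `gₙ(σ)` is the coefficient of `zⁿ` in `((1+z)/(1-z))^σ`. -/
def mittagLeffler (n : ℕ) (σ : ℂ) : ℂ :=
  if n = 0 then 1 else 2 * σ * ordinaryHypergeometric (1 - (n : ℂ)) (1 - σ) (2 : ℂ) (2 : ℂ)

/-- The Pochhammer symbol `(a)ₙ = a(a+1)⋯(a+n-1)`. -/
def poch (a : ℂ) (n : ℕ) : ℂ := (ascPochhammer ℂ n).eval a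

/-- The coefficient `(μ-ν)ₙ gₙ(σ) ((1-x)/(1+x))^(n/2)`. -/
def seriesCoeff (ν σ μ : ℂ) (x : ℝ) (n : ℕ) : ℂ :=
  poch (μ - ν) n * mittagLeffler n σ * ((((1 - x) / (1 + x)) ^ ((n : ℝ) / 2) : ℝ) : ℂ)

end

/-! Put y = (1-x)/(1+x). The Pfaff transformation gives P_ν^{-μ}(x) = y^{μ/2} ((1+x)/2)^ν F(-ν, μ-ν;
1+μ; -y)/Γ(1+μ) (`legendreP_neg`), and x ↦ 1/x only flips the sign of y, up to the factor x^ν. Both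
expansions thus relate regularized F at y and at -y. Expand F inside such a series: (μ-ν)_n
(μ+n-ν)_k = (μ-ν)_{n+k} and Γ(1+μ+n+k) depend only on n+k. Summing over n+k = N therefore leaves a
Cauchy product, and both claims reduce to ((1+X)/(1-X))^{±ν} (1∓X)^ν = (1±X)^ν
(`hasSum_regularizedGaussHGFun_neg`), given the generating function `mk_mittagLeffler`. The same
collapse turns mutual inversion into G_σ G_{-σ} = 1, where G_σ = ((1+X)/(1-X))^σ. -/

/-! ### Pochhammer symbols and formal binomial series. -/

/-- The power series of `(1 - X) ^ (-a)`. -/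
noncomputable def pochSeries (a : ℂ) : PowerSeries ℂ :=
  PowerSeries.mk fun n => poch a n / (n.factorial : ℂ)

theorem poch_zero (a : ℂ) : poch a 0 = 1 := by simp [poch]

theorem poch_succ (a : ℂ) (n : ℕ) : poch a (n + 1) = poch a n * (a + n) := by
  simp [poch, ascPochhammer_succ_eval]

theorem poch_add (a : ℂ) (n k : ℕ) : poch a (n + k) = poch a n * poch (a + n) k := by
  induction k with
  | zero => simp [poch_zero]
  | succ k ih => rw [← add_assoc, poch_succ, poch_succ, ih]; push_cast; ring

theorem poch_succ' (a : ℂ) (n : ℕ) : poch a (n + 1) = a * poch (a + 1) n := by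
  rw [add_comm, poch_add]; simp [poch]

theorem poch_div_factorial (a : ℂ) (n : ℕ) :
    poch a n / (n.factorial : ℂ) = Ring.multichoose a n := by
  have h := Ring.factorial_nsmul_multichoose_eq_ascPochhammer a n
  rw [Polynomial.ascPochhammer_smeval_eq_eval] at h
  rw [poch, ← h, nsmul_eq_mul, mul_div_cancel_left₀]
  exact_mod_cast n.factorial_ne_zero

theorem pochSeries_eq (a : ℂ) :
    pochSeries a = PowerSeries.rescale (-1) (PowerSeries.binomialSeries ℂ (-a)) := by
  ext n
  rw [pochSeries, PowerSeries.coeff_mk, PowerSeries.coeff_rescale,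
    PowerSeries.binomialSeries_coeff, poch_div_factorial, Ring.choose_neg, Ring.multichoose_eq]
  simp [Units.smul_def, ← mul_assoc, ← mul_pow]

theorem pochSeries_mul (a b : ℂ) : pochSeries a * pochSeries b = pochSeries (a + b) := by
  rw [pochSeries_eq, pochSeries_eq, pochSeries_eq, ← map_mul, neg_add,
    PowerSeries.binomialSeries_add]

theorem pochSeries_zero : pochSeries 0 = 1 := by
  simp [pochSeries_eq]

theorem pochSeries_neg_natCast (m : ℕ) : pochSeries (-(m : ℂ)) = (1 - PowerSeries.X) ^ m := by
  rw [pochSeries_eq, neg_neg, PowerSeries.binomialSeries_nat]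
  simp [sub_eq_add_neg, PowerSeries.rescale_X]

theorem pochSeries_mul_one_sub_pow (m : ℕ) :
    pochSeries (m : ℂ) * (1 - PowerSeries.X) ^ m = 1 := by
  rw [← pochSeries_neg_natCast, pochSeries_mul, add_neg_cancel, pochSeries_zero]

theorem rescale_pochSeries_neg_natCast (m : ℕ) :
    PowerSeries.rescale (-1) (pochSeries (-(m : ℂ))) = (1 + PowerSeries.X) ^ m := by
  rw [pochSeries_neg_natCast]
  simp [sub_eq_add_neg, PowerSeries.rescale_X]

/-- Both sides are coefficients of the inverse of (1-X)^(j+1). -/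
theorem poch_natCast_succ_div_factorial (j i : ℕ) :
    poch ((j : ℂ) + 1) i / (i.factorial : ℂ) = ((j + i).choose j : ℂ) := by
  have h := pochSeries_mul_one_sub_pow (j + 1)
  have h2 := PowerSeries.mk_add_choose_mul_one_sub_pow_eq_one ℂ j
  have h3 := congrArg (PowerSeries.coeff i) (mul_right_cancel₀ (by
    intro h0; rw [h0, mul_zero] at h; exact zero_ne_one h) (h.trans h2.symm))
  simpa [pochSeries] using h3

/-! ### Generating function of the Mittag-Leffler polynomials. -/

/-- Functions of `σ` given by a polynomial. -/
def IsPolyFun (f : ℂ → ℂ) : Prop := ∃ p : Polynomial ℂ, ∀ σ, f σ = p.eval σ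

theorem IsPolyFun.mul {f g : ℂ → ℂ} (hf : IsPolyFun f) (hg : IsPolyFun g) :
    IsPolyFun fun σ => f σ * g σ := by
  obtain ⟨p, hp⟩ := hf
  obtain ⟨q, hq⟩ := hg
  exact ⟨p * q, by simp [hp, hq]⟩

theorem isPolyFun_const (c : ℂ) : IsPolyFun fun _ => c := ⟨Polynomial.C c, by simp⟩

theorem IsPolyFun.sum {ι : Type*} (s : Finset ι) {f : ι → ℂ → ℂ} (hf : ∀ i, IsPolyFun (f i)) :
    IsPolyFun fun σ => ∑ i ∈ s, f i σ := by
  choose p hp using hf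
  exact ⟨∑ i ∈ s, p i, by simp [hp, Polynomial.eval_finsetSum]⟩

theorem isPolyFun_poch (n : ℕ) : IsPolyFun fun σ => poch σ n := ⟨ascPochhammer ℂ n, by simp [poch]⟩

theorem IsPolyFun.comp {f g : ℂ → ℂ} (hf : IsPolyFun f) (hg : IsPolyFun g) :
    IsPolyFun fun σ => f (g σ) := by
  obtain ⟨p, hp⟩ := hf
  obtain ⟨q, hq⟩ := hg
  exact ⟨p.comp q, by simp [hp, hq]⟩

theorem IsPolyFun.eq_of_natCast {f g : ℂ → ℂ} (hf : IsPolyFun f) (hg : IsPolyFun g)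
    (h : ∀ m : ℕ, f m = g m) : f = g := by
  obtain ⟨p, hp⟩ := hf
  obtain ⟨q, hq⟩ := hg
  have hpq : p = q := by
    refine Polynomial.eq_of_infinite_eval_eq p q ?_
    refine (Set.infinite_range_of_injective (Nat.cast_injective (R := ℂ))).mono ?_
    rintro _ ⟨m, rfl⟩
    simpa [← hp, ← hq] using h m
  funext σ
  rw [hp, hq, hpq]

theorem poch_neg_natCast (n j : ℕ) :
    poch (-(n : ℂ)) j = (-1) ^ j * (j.factorial : ℂ) * (n.choose j : ℂ) := by
  have h := poch_div_factorial (-(n : ℂ)) j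
  rw [Ring.multichoose_eq, show -(n : ℂ) + j - 1 = -((n : ℂ) - j + 1) by ring, Ring.choose_neg,
    show (n : ℂ) - j + 1 + j - 1 = n by ring, Ring.choose_natCast,
    div_eq_iff (by exact_mod_cast j.factorial_ne_zero)] at h
  rw [h]
  simp [Units.smul_def]
  ring

theorem mittagLeffler_zero (σ : ℂ) : mittagLeffler 0 σ = 1 := by simp [mittagLeffler]

theorem mittagLeffler_succ (n : ℕ) (σ : ℂ) :
    mittagLeffler (n + 1) σ = ∑ j ∈ Finset.range (n + 1),
      ((n.choose j : ℂ) * 2 ^ (j + 1) * (((j + 1).factorial : ℂ)⁻¹ * (-1) ^ (j + 1))) *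
        poch (-σ) (j + 1) := by
  have h2 (j : ℕ) : (ascPochhammer ℂ j).eval 2 = ((j + 1).factorial : ℂ) := by
    have h := poch_succ' 1 j
    rw [poch, one_mul, one_add_one_eq_two] at h
    rw [← poch, ← h]
    simp [ascPochhammer_eval_one]
  have hn (j : ℕ) : (ascPochhammer ℂ j).eval (1 - ((n + 1 : ℕ) : ℂ)) =
      (-1) ^ j * (j.factorial : ℂ) * (n.choose j : ℂ) := by
    rw [← poch_neg_natCast, poch]; push_cast; congr 1; ring
  rw [mittagLeffler, if_neg (Nat.succ_ne_zero n), ordinaryHypergeometric_eq_tsum]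
  dsimp only
  rw [tsum_eq_sum (s := Finset.range (n + 1)), Finset.mul_sum]
  · refine Finset.sum_congr rfl fun j _ => ?_
    have hj : (j.factorial : ℂ) ≠ 0 := by exact_mod_cast j.factorial_ne_zero
    rw [hn, h2, poch_succ', show -σ + 1 = 1 - σ by ring, ← poch, smul_eq_mul]
    field_simp
    ring
  · intro j hj
    rw [hn, Nat.choose_eq_zero_of_lt (by simpa using hj)]
    simp

/-- The right side is the binomial expansion of (1 + 2X/(1-X))^m. -/
theorem mk_mittagLeffler_natCast (m : ℕ) :
    PowerSeries.mk (fun n => mittagLeffler n (m : ℂ)) = ∑ k ∈ Finset.range (m + 1),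
      ((m.choose k : ℂ) * 2 ^ k) • (PowerSeries.X ^ k * pochSeries k) := by
  ext n
  rw [PowerSeries.coeff_mk, map_sum, Finset.sum_range_succ']
  cases n with
  | zero =>
    rw [mittagLeffler_zero, Finset.sum_eq_zero]
    · simp [pochSeries_zero]
    · intro k _
      simp
  | succ n =>
    rw [mittagLeffler_succ]
    simp only [Nat.cast_zero, pochSeries_zero, PowerSeries.coeff_smul,
      PowerSeries.coeff_X_pow_mul']
    simp only [PowerSeries.coeff_one, Nat.add_le_add_iff_right, Nat.add_sub_add_right]
    have hl : ∀ j, ((n.choose j : ℂ) * 2 ^ (j + 1) * (((j + 1).factorial : ℂ)⁻¹ * (-1) ^ (j + 1))) *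
        poch (-(m : ℂ)) (j + 1) = (m.choose (j + 1) : ℂ) * 2 ^ (j + 1) * (n.choose j : ℂ) := by
      intro j
      have hj : ((j + 1).factorial : ℂ) ≠ 0 := by exact_mod_cast (j + 1).factorial_ne_zero
      rw [poch_neg_natCast]
      field_simp
      rw [← pow_mul]
      simp
    have hr : ∀ j, (if j ≤ n then PowerSeries.coeff (n - j) (pochSeries ((j + 1 : ℕ) : ℂ)) else 0) =
        (n.choose j : ℂ) := by
      intro j
      split_ifs with h
      · rw [pochSeries, PowerSeries.coeff_mk, Nat.cast_succ, poch_natCast_succ_div_factorial,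
          Nat.add_sub_cancel' h]
      · rw [Nat.choose_eq_zero_of_lt (not_le.1 h), Nat.cast_zero]
    simp only [hl, hr, smul_eq_mul]
    simp only [Nat.zero_le, if_true, Nat.sub_zero, Nat.succ_ne_zero, if_false, mul_zero, add_zero]
    -- Both sums are padded to a common range; the added terms have a vanishing binomial
    -- coefficient.
    trans ∑ j ∈ Finset.range (n + 1 + m), (m.choose (j + 1) : ℂ) * 2 ^ (j + 1) * (n.choose j : ℂ)
    · refine Finset.sum_subset (by simp) fun j _ hj => ?_
      rw [Nat.choose_eq_zero_of_lt (n := n) (by simpa using hj)]; simp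
    · refine (Finset.sum_subset (by simp) fun j _ hj => ?_).symm
      rw [Nat.choose_eq_zero_of_lt (n := m) (by simp at hj; omega)]; simp

/-- The generating function `((1 + X) / (1 - X)) ^ σ` of the Mittag-Leffler polynomials. -/
theorem mk_mittagLeffler (σ : ℂ) :
    PowerSeries.mk (fun n => mittagLeffler n σ) =
      pochSeries σ * PowerSeries.rescale (-1) (pochSeries (-σ)) := by
  ext n
  rw [PowerSeries.coeff_mk]
  have hneg : IsPolyFun fun σ => -σ := ⟨-Polynomial.X, by simp⟩
  refine congrFun (f := fun σ => mittagLeffler n σ)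
    (g := fun σ => PowerSeries.coeff n
      (pochSeries σ * PowerSeries.rescale (-1) (pochSeries (-σ)))) ?_ σ
  -- Each coefficient is a polynomial in σ, so natural σ = m suffice.
  refine IsPolyFun.eq_of_natCast ?_ ?_ fun m => ?_
  · cases n with
    | zero => simpa only [mittagLeffler_zero] using isPolyFun_const 1
    | succ n =>
      simp only [mittagLeffler_succ]
      exact IsPolyFun.sum _ fun j => (isPolyFun_const _).mul ((isPolyFun_poch _).comp hneg)
  · simp only [PowerSeries.coeff_mul, PowerSeries.coeff_rescale, pochSeries, PowerSeries.coeff_mk,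
      div_eq_mul_inv]
    exact IsPolyFun.sum _ fun j => ((isPolyFun_poch _).mul (isPolyFun_const _)).mul
      ((isPolyFun_const _).mul (((isPolyFun_poch _).comp hneg).mul (isPolyFun_const _)))
  · rw [← PowerSeries.coeff_mk n fun n => mittagLeffler n (m : ℂ)]
    congr 1
    have hkey : PowerSeries.mk (fun n => mittagLeffler n (m : ℂ)) * (1 - PowerSeries.X) ^ m =
        (1 + PowerSeries.X) ^ m := by
      rw [mk_mittagLeffler_natCast, Finset.sum_mul,
        show (1 : PowerSeries ℂ) + PowerSeries.X = 2 * PowerSeries.X + (1 - PowerSeries.X) by ring,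
        add_pow]
      refine Finset.sum_congr rfl fun k hk => ?_
      have hk' : k ≤ m := by simpa [Nat.lt_succ_iff] using hk
      rw [← Nat.add_sub_cancel' hk', pow_add, Nat.add_sub_cancel' hk', PowerSeries.smul_eq_C_mul]
      have := pochSeries_mul_one_sub_pow k
      simp only [map_mul, map_pow, map_natCast, map_ofNat]
      linear_combination (m.choose k : PowerSeries ℂ) * 2 ^ k * PowerSeries.X ^ k *
        (1 - PowerSeries.X) ^ (m - k) * this
    rw [rescale_pochSeries_neg_natCast, ← hkey]
    linear_combination -PowerSeries.mk (fun n => mittagLeffler n (m : ℂ)) *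
      pochSeries_mul_one_sub_pow m

/-! ### Double series: rearrangement and convergence. -/

open Finset in
theorem hasSum_of_hasSum_antidiagonal {f : ℕ × ℕ → ℂ} (hf : Summable f) {g h : ℕ → ℂ} {s : ℂ}
    (hg : ∀ N, ∑ p ∈ antidiagonal N, f p = g N) (hs : HasSum g s)
    (hh : ∀ n, HasSum (fun k => f (n, k)) (h n)) : HasSum h s := by
  have h1 := hf.hasSum.prod_fiberwise hh
  have h2 := (HasAntidiagonal.sigmaAntidiagonalEquivProd.hasSum_iff.2 hf.hasSum).sigma
    (g := g) fun N => by
      rw [← hg N, ← Finset.sum_coe_sort (antidiagonal N)]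
      exact hasSum_fintype _
  rwa [h2.unique hs] at h1

/-- Write y = s·s with s = √y < 1: one power of s keeps `w` bounded, the other makes the `u` and `v`
series converge. -/
theorem summable_mul_mul_pow_add {u v w : ℕ → ℝ} (hu0 : ∀ n, 0 ≤ u n) (hv0 : ∀ n, 0 ≤ v n)
    (hw0 : ∀ n, 0 ≤ w n) (hu : ∀ r : ℝ, 0 ≤ r → r < 1 → Summable fun n => u n * r ^ n)
    (hv : ∀ r : ℝ, 0 ≤ r → r < 1 → Summable fun n => v n * r ^ n)
    (hw : ∀ r : ℝ, 0 ≤ r → r < 1 → Summable fun n => w n * r ^ n) {y : ℝ} (hy0 : 0 ≤ y)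
    (hy1 : y < 1) :
    Summable fun p : ℕ × ℕ => u p.1 * v p.2 * w (p.1 + p.2) * y ^ (p.1 + p.2) := by
  set s := √y
  have hs0 : 0 ≤ s := Real.sqrt_nonneg y
  have hs1 : s < 1 := by rw [Real.sqrt_lt' one_pos]; simpa using hy1
  have hy : y = s * s := (Real.mul_self_sqrt hy0).symm
  obtain ⟨C, hC⟩ := (hw s hs0 hs1).tendsto_atTop_zero.bddAbove_range
  have hC' : ∀ n, w n * s ^ n ≤ C := fun n => hC ⟨n, rfl⟩
  have hsum := ((hu s hs0 hs1).mul_of_nonneg (hv s hs0 hs1)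
    (fun n => mul_nonneg (hu0 n) (pow_nonneg hs0 n))
    (fun n => mul_nonneg (hv0 n) (pow_nonneg hs0 n))).mul_left C
  refine Summable.of_nonneg_of_le (fun p => ?_) (fun p => ?_) hsum
  · have := hu0 p.1; have := hv0 p.2; have := hw0 (p.1 + p.2)
    positivity
  · have h := mul_le_mul_of_nonneg_right (hC' (p.1 + p.2))
      (mul_nonneg (mul_nonneg (hu0 p.1) (pow_nonneg hs0 p.1))
        (mul_nonneg (hv0 p.2) (pow_nonneg hs0 p.2)))
    refine le_trans (le_of_eq ?_) h
    rw [hy]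
    ring

/-- These are the coefficients of F(a,1;c;·)/Γ(c), since (1)_n = n! cancels. -/
theorem summable_norm_poch_mul_inv_Gamma (a c : ℂ) (r : ℝ) (hr0 : 0 ≤ r) (hr1 : r < 1) :
    Summable fun n : ℕ => ‖poch a n * (Complex.Gamma (c + n))⁻¹‖ * r ^ n := by
  lift r to NNReal using hr0
  have h := (Complex.regularizedGaussHGFunSeries a 1 c).summable_norm_mul_pow (r := r)
    (lt_of_lt_of_le (by exact_mod_cast hr1)
      (Complex.radius_regularizedGaussHGFunSeries_ge_one a 1 c))
  refine h.congr fun n => ?_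
  rw [FormalMultilinearSeries.norm_apply_eq_norm_coef, Complex.coeff_regularizedGaussHGFunSeries,
    ascPochhammer_eval_one, ← poch, mul_comm (n.factorial : ℂ),
    mul_div_mul_right _ _ (by exact_mod_cast n.factorial_ne_zero), div_eq_mul_inv]

theorem summable_norm_poch_div_factorial (a : ℂ) (r : ℝ) (hr0 : 0 ≤ r) (hr1 : r < 1) :
    Summable fun n : ℕ => ‖poch a n / (n.factorial : ℂ)‖ * r ^ n := by
  refine (summable_norm_poch_mul_inv_Gamma a 1 r hr0 hr1).congr fun n => ?_
  rw [add_comm (1 : ℂ), Complex.Gamma_nat_eq_factorial, div_eq_mul_inv]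

theorem summable_norm_mittagLeffler (σ : ℂ) (r : ℝ) (hr0 : 0 ≤ r) (hr1 : r < 1) :
    Summable fun n : ℕ => ‖mittagLeffler n σ‖ * r ^ n := by
  have h1 : Summable fun n : ℕ => ‖poch σ n / (n.factorial : ℂ) * (r : ℂ) ^ n‖ := by
    simpa [abs_of_nonneg hr0] using summable_norm_poch_div_factorial σ r hr0 hr1
  have h2 : Summable fun n : ℕ => ‖poch (-σ) n / (n.factorial : ℂ) * (-r : ℂ) ^ n‖ := by
    simpa [abs_of_nonneg hr0] using summable_norm_poch_div_factorial (-σ) r hr0 hr1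
  refine (summable_norm_sum_mul_antidiagonal_of_summable_norm h1 h2).congr fun n => ?_
  have h := congrArg (PowerSeries.coeff n) (mk_mittagLeffler σ)
  rw [PowerSeries.coeff_mk, PowerSeries.coeff_mul] at h
  rw [h, ← abs_of_nonneg (pow_nonneg hr0 n), ← Real.norm_eq_abs, ← Complex.norm_real, ← norm_mul,
    Finset.sum_mul]
  congr 1
  refine Finset.sum_congr rfl fun p hp => ?_
  rw [← Finset.HasAntidiagonal.mem_antidiagonal.1 hp, PowerSeries.coeff_rescale, pochSeries, pochSeries,
    PowerSeries.coeff_mk, PowerSeries.coeff_mk, neg_pow]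
  push_cast
  ring

/-! ### The Pfaff transformation. -/

theorem hasSum_regularizedGaussHGFun (a b c : ℂ) {z : ℂ} (hz : ‖z‖ < 1) :
    HasSum (fun n : ℕ => poch a n / (n.factorial : ℂ) *
      (poch b n * (Complex.Gamma (c + n))⁻¹) * z ^ n)
      (Complex.regularizedGaussHGFun a b c z) := by
  have h := (Complex.regularizedGaussHGFunSeries a b c).hasSum (x := z) (by
    refine Metric.eball_subset_eball (Complex.radius_regularizedGaussHGFunSeries_ge_one a b c) ?_
    simpa [enorm_eq_nnnorm] using (by exact_mod_cast hz : ‖z‖₊ < 1))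
  convert! h using 2 with n
  rw [FormalMultilinearSeries.apply_eq_pow_smul_coeff,
    Complex.coeff_regularizedGaussHGFunSeries, ← poch, ← poch, smul_eq_mul]
  ring

/-- Holds at the poles too: there `Complex.Gamma` is 0, so its inverse is the true value 0 of 1/Γ.
-/
theorem inv_Gamma_eq_poch_mul (c : ℂ) (n : ℕ) :
    (Complex.Gamma c)⁻¹ = poch c n * (Complex.Gamma (c + n))⁻¹ := by
  induction n with
  | zero => simp [poch_zero]
  | succ n ih =>
    rw [ih, poch_succ, Complex.one_div_Gamma_eq_self_mul_one_div_Gamma_add_one (c + n)]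
    push_cast
    ring_nf

theorem poch_reflect (a : ℂ) (n : ℕ) : poch (1 - a - n) n = (-1) ^ n * poch a n := by
  induction n generalizing a with
  | zero => simp [poch_zero]
  | succ n ih =>
    rw [poch_succ', poch_succ, show 1 - a - ((n + 1 : ℕ) : ℂ) + 1 = 1 - a - n by push_cast; ring, ih]
    push_cast
    ring

open Finset in
theorem poch_add_div_factorial (a b : ℂ) (N : ℕ) :
    ∑ p ∈ antidiagonal N, poch a p.1 / (p.1.factorial : ℂ) * (poch b p.2 / (p.2.factorial : ℂ)) =
      poch (a + b) N / (N.factorial : ℂ) := by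
  have h := congrArg (PowerSeries.coeff N) (pochSeries_mul a b)
  simpa [PowerSeries.coeff_mul, pochSeries] using h

-- Chu–Vandermonde with parameters c-b and 1-c-N, the latter reflected; this is the coefficient
-- comparison behind Pfaff.
open Finset in
theorem sum_antidiagonal_poch_sub (b c : ℂ) (N : ℕ) :
    ∑ p ∈ antidiagonal N, (-1) ^ p.1 * (poch (c - b) p.1 * (Complex.Gamma (c + p.1))⁻¹) /
      ((p.1.factorial : ℂ) * (p.2.factorial : ℂ)) =
      poch b N * (Complex.Gamma (c + N))⁻¹ / (N.factorial : ℂ) := by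
  have h := poch_add_div_factorial (c - b) (1 - c - N) N
  rw [show c - b + (1 - c - N) = 1 - b - N by ring, poch_reflect] at h
  have h1 : poch b N / (N.factorial : ℂ) = (-1) ^ N * ((-1) ^ N * poch b N / (N.factorial : ℂ)) := by
    rw [mul_div_assoc, ← mul_assoc, ← mul_pow]; simp
  rw [mul_div_right_comm, h1, ← h, mul_sum, sum_mul]
  refine sum_congr rfl fun p hp => ?_
  have hN : ((p.1 + p.2 : ℕ) : ℂ) = N := by rw [HasAntidiagonal.mem_antidiagonal.1 hp]
  rw [inv_Gamma_eq_poch_mul (c + p.1) p.2,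
    show 1 - c - (N : ℂ) = 1 - (c + p.1) - p.2 by rw [← hN]; push_cast; ring, poch_reflect,
    show c + p.1 + p.2 = c + N by rw [← hN]; push_cast; ring, ← HasAntidiagonal.mem_antidiagonal.1 hp, pow_add]
  have h2 : ((-1 : ℂ) ^ p.2) * (-1) ^ p.2 = 1 := by rw [← mul_pow]; simp
  linear_combination (-(-1) ^ p.1 * (poch (c - b) p.1 * (poch (c + p.1) p.2 *
    (Complex.Gamma (c + ↑(p.1 + p.2)))⁻¹)) / ((p.1.factorial : ℂ) * (p.2.factorial : ℂ))) * h2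

theorem hasSum_one_sub_cpow (a : ℂ) {z : ℂ} (hz : ‖z‖ < 1) :
    HasSum (fun n : ℕ => poch a n / (n.factorial : ℂ) * z ^ n) ((1 - z) ^ (-a)) := by
  have h := (Complex.one_div_one_sub_cpow_hasFPowerSeriesOnBall_zero a).hasSum (y := z) (by
    simpa [enorm_eq_nnnorm] using (by exact_mod_cast hz : ‖z‖₊ < 1))
  rw [zero_add, one_div, ← Complex.cpow_neg] at h
  convert! h using 2 with n
  rw [poch_div_factorial, Ring.multichoose_eq]
  simp [mul_comm]

open Finset in
/-- The Pfaff transformation on the interval where the rearranged double series converges. -/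
theorem regularizedGaussHGFun_pfaff (a b c : ℂ) {t : ℝ} (ht0 : 0 ≤ t) (ht1 : t < 1 / 2) :
    Complex.regularizedGaussHGFun a b c (t : ℂ) = ((1 - t : ℝ) : ℂ) ^ (-a) *
      Complex.regularizedGaussHGFun a (c - b) c ((t / (t - 1) : ℝ) : ℂ) := by
  have htn : ‖(t : ℂ)‖ < 1 := by
    rw [Complex.norm_real, Real.norm_eq_abs, abs_of_nonneg ht0]; linarith
  have hun : ‖((t / (t - 1) : ℝ) : ℂ)‖ < 1 := by
    rw [Complex.norm_real, Real.norm_eq_abs, abs_div, abs_of_nonneg ht0,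
      abs_of_neg (by linarith), div_lt_one (by linarith)]
    linarith
  have h1t : (1 - (t : ℂ)) ≠ 0 := by
    rw [← Complex.ofReal_one, ← Complex.ofReal_sub, Complex.ofReal_ne_zero]; linarith
  -- Rows sum by the binomial series of (1-t)^(-a-k), antidiagonals by Chu–Vandermonde.
  set f : ℕ × ℕ → ℂ := fun p =>
    (-1) ^ p.1 * (poch (c - b) p.1 * (Complex.Gamma (c + p.1))⁻¹) /
      ((p.1.factorial : ℂ) * (p.2.factorial : ℂ)) * (poch a (p.1 + p.2) * (t : ℂ) ^ (p.1 + p.2))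
    with hf_def
  have hf : Summable f := by
    refine Summable.of_norm_bounded (summable_mul_mul_pow_add
      (u := fun n => ‖poch (c - b) n * (Complex.Gamma (c + n))⁻¹‖) (v := fun _ => 1)
      (w := fun n => ‖poch a n / (n.factorial : ℂ)‖) (fun _ => norm_nonneg _)
      (fun _ => zero_le_one) (fun _ => norm_nonneg _) (summable_norm_poch_mul_inv_Gamma _ _)
      (fun r h0 h1 => by simpa using summable_geometric_of_lt_one h0 h1)
      (summable_norm_poch_div_factorial a) (y := 2 * t) (by linarith) (by linarith)) fun p => ?_
    obtain ⟨k, j⟩ := p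
    -- 1/(k! j!) ≤ 2^(k+j)/(k+j)!, whence the majorant in powers of 2t and the need for t < 1/2.
    have hch : ((k + j).choose k : ℝ) ≤ 2 ^ (k + j) := by exact_mod_cast Nat.choose_le_two_pow _ _
    have hfac : ((k + j).choose k : ℝ) * k.factorial * j.factorial = (k + j).factorial := by
      rw [Nat.choose_symm_add]
      exact_mod_cast Nat.add_choose_mul_factorial_mul_factorial k j
    have hk : (k.factorial : ℝ) ≠ 0 := by exact_mod_cast k.factorial_ne_zero
    have hj : (j.factorial : ℝ) ≠ 0 := by exact_mod_cast j.factorial_ne_zero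
    have hkj : ((k + j).factorial : ℝ) ≠ 0 := by exact_mod_cast (k + j).factorial_ne_zero
    have hinv : ((k.factorial : ℝ) * j.factorial)⁻¹ =
        ((k + j).choose k : ℝ) / (k + j).factorial := by
      field_simp
      linarith
    simp only [hf_def, norm_mul, norm_div, norm_pow, norm_neg, norm_one, one_pow, one_mul, mul_one,
      Complex.norm_real, Real.norm_eq_abs, abs_of_nonneg ht0, Complex.norm_natCast]
    rw [div_eq_mul_inv, hinv, mul_pow]
    calc _ = ‖poch (c - b) k‖ * ‖(Complex.Gamma (c + k))⁻¹‖ *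
          (‖poch a (k + j)‖ / (k + j).factorial) * t ^ (k + j) * ((k + j).choose k : ℝ) := by ring
      _ ≤ ‖poch (c - b) k‖ * ‖(Complex.Gamma (c + k))⁻¹‖ *
          (‖poch a (k + j)‖ / (k + j).factorial) * t ^ (k + j) * 2 ^ (k + j) := by gcongr
      _ = _ := by ring
  refine (hasSum_of_hasSum_antidiagonal hf (fun N => ?_) (hasSum_regularizedGaussHGFun a b c htn)
    fun k => ?_).unique ((hasSum_regularizedGaussHGFun a (c - b) c hun).mul_left
      (((1 - t : ℝ) : ℂ) ^ (-a)))
  · have h := sum_antidiagonal_poch_sub b c N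
    trans (poch b N * (Complex.Gamma (c + N))⁻¹ / (N.factorial : ℂ)) * (poch a N * (t : ℂ) ^ N)
    · rw [← h, sum_mul]
      refine sum_congr rfl fun p hp => ?_
      rw [hf_def, ← HasAntidiagonal.mem_antidiagonal.1 hp]
    · ring
  · have h := (hasSum_one_sub_cpow (a + k) htn).mul_left
      ((-1) ^ k * (poch (c - b) k * (Complex.Gamma (c + k))⁻¹) / (k.factorial : ℂ) *
        (poch a k * (t : ℂ) ^ k))
    have hpow : (1 - (t : ℂ)) ^ (-(a + k)) = (1 - (t : ℂ)) ^ (-a) * ((1 - (t : ℂ)) ^ k)⁻¹ := by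
      rw [neg_add, Complex.cpow_add _ _ h1t, Complex.cpow_neg _ (k : ℂ), Complex.cpow_natCast]
    have hval : (-1) ^ k * (poch (c - b) k * (Complex.Gamma (c + k))⁻¹) / (k.factorial : ℂ) *
        (poch a k * (t : ℂ) ^ k) * (1 - (t : ℂ)) ^ (-(a + k)) = ((1 - t : ℝ) : ℂ) ^ (-a) *
          (poch a k / (k.factorial : ℂ) * (poch (c - b) k * (Complex.Gamma (c + k))⁻¹) *
            ((t / (t - 1) : ℝ) : ℂ) ^ k) := by
      have hneg : ((t / (t - 1) : ℝ) : ℂ) = -1 * (t / (1 - (t : ℂ))) := by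
        push_cast
        rw [← neg_sub 1 (t : ℂ), div_neg, neg_one_mul]
      rw [hpow, hneg, mul_pow, div_pow]
      push_cast
      ring
    rw [hval] at h
    convert! h using 2 with j
    rw [hf_def]
    simp only
    rw [poch_add, pow_add]
    have hk : (k.factorial : ℂ) ≠ 0 := by exact_mod_cast k.factorial_ne_zero
    have hj : (j.factorial : ℂ) ≠ 0 := by exact_mod_cast j.factorial_ne_zero
    field_simp

theorem gaussReg_pfaff (a b c : ℂ) {t : ℝ} (ht : t < 1 / 2) :
    gaussReg a b c t = ((1 - t : ℝ) : ℂ) ^ (-a) *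
      Complex.regularizedGaussHGFun a (c - b) c ((t / (t - 1) : ℝ) : ℂ) := by
  rw [gaussReg]
  split_ifs with h
  · rcases le_or_gt 0 t with h0 | h0
    · exact regularizedGaussHGFun_pfaff a b c h0 ht
    -- The involution t ↦ t/(t-1) sends this t into (0, 1/2), where the proved case applies and is
    -- inverted.
    · have h1 : t - 1 < 0 := by linarith
      have hu : t / (t - 1) / (t / (t - 1) - 1) = t := by
        have : t - 1 ≠ 0 := h1.ne
        field_simp
        ring
      have hu1 : t / (t - 1) < 1 / 2 := by
        rw [div_lt_iff_of_neg h1]; linarith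
      rw [regularizedGaussHGFun_pfaff a (c - b) c (div_nonneg_of_nonpos h0.le h1.le) hu1, hu,
        sub_sub_cancel, ← mul_assoc, ← Complex.mul_cpow_ofReal_nonneg (by linarith) (by linarith),
        ← Complex.ofReal_mul]
      have h2 : (1 - t) * (1 - t / (t - 1)) = 1 := by
        have : t - 1 ≠ 0 := h1.ne
        field_simp
        ring
      rw [h2]
      simp
  · rfl

/-! ### Legendre functions and the two expansions. -/

theorem legendreP_neg (ν m : ℂ) {x : ℝ} (hx : 0 < x) :
    legendreP ν (-m) x = ((|(1 - x) / (1 + x)| : ℝ) : ℂ) ^ (m / 2) *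
      ((((1 + x) / 2 : ℝ) : ℂ) ^ ν *
        Complex.regularizedGaussHGFun (-ν) (m - ν) (1 + m) (((x - 1) / (x + 1) : ℝ) : ℂ)) := by
  rw [legendreP, gaussReg_pfaff _ _ _ (by linarith)]
  have h1 : (1 - x) / 2 / ((1 - x) / 2 - 1) = (x - 1) / (x + 1) := by
    have h2 : (1 - x) / 2 - 1 ≠ 0 := by linarith
    have h3 : x + 1 ≠ 0 := by linarith
    rw [div_eq_div_iff h2 h3]
    ring
  rw [h1, neg_neg, neg_neg, sub_neg_eq_add, show 1 + m - (ν + 1) = m - ν by ring,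
    show 1 - (1 - x) / 2 = (1 + x) / 2 by ring]

-- The sign `ε` treats both expansions at once: 1 gives the first, -1 the second, and `H` is the
-- power series identity each needs.
open Finset in
theorem hasSum_regularizedGaussHGFun_neg (μ ν σ : ℂ) (ε : ℝ) (hε : |ε| = 1)
    (H : PowerSeries.mk (fun n => mittagLeffler n σ) *
      PowerSeries.rescale (ε : ℂ) (pochSeries (-ν)) =
        PowerSeries.rescale (-ε : ℂ) (pochSeries (-ν)))
    {y : ℝ} (hy0 : 0 ≤ y) (hy1 : y < 1) :
    HasSum (fun n : ℕ => poch (μ - ν) n * mittagLeffler n σ * ((y : ℂ) ^ n *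
      Complex.regularizedGaussHGFun (-ν) (μ + n - ν) (1 + (μ + n)) ((ε * y : ℝ) : ℂ)))
      (Complex.regularizedGaussHGFun (-ν) (μ - ν) (1 + μ) ((-ε * y : ℝ) : ℂ)) := by
  have hn1 : ‖((ε * y : ℝ) : ℂ)‖ < 1 := by
    rwa [Complex.norm_real, Real.norm_eq_abs, abs_mul, hε, one_mul, abs_of_nonneg hy0]
  have hn2 : ‖((-ε * y : ℝ) : ℂ)‖ < 1 := by
    rwa [Complex.norm_real, Real.norm_eq_abs, abs_mul, abs_neg, hε, one_mul, abs_of_nonneg hy0]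
  set f : ℕ × ℕ → ℂ := fun p =>
    mittagLeffler p.1 σ * ((ε : ℂ) ^ p.2 * (poch (-ν) p.2 / (p.2.factorial : ℂ))) *
      (poch (μ - ν) (p.1 + p.2) * (Complex.Gamma (1 + μ + ((p.1 + p.2 : ℕ) : ℂ)))⁻¹) *
        (y : ℂ) ^ (p.1 + p.2) with hf_def
  have hf : Summable f := by
    refine Summable.of_norm (Summable.congr (summable_mul_mul_pow_add
      (fun _ => norm_nonneg _) (fun _ => norm_nonneg _) (fun _ => norm_nonneg _)
      (summable_norm_mittagLeffler σ) (summable_norm_poch_div_factorial (-ν))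
      (summable_norm_poch_mul_inv_Gamma (μ - ν) (1 + μ)) hy0 hy1) fun p => ?_)
    simp only [hf_def, norm_mul, norm_pow, Complex.norm_real, Real.norm_eq_abs, hε,
      abs_of_nonneg hy0, one_pow, one_mul]
  refine hasSum_of_hasSum_antidiagonal hf (fun N => ?_) (hasSum_regularizedGaussHGFun _ _ _ hn2)
    fun n => ?_
  · have h := congrArg (PowerSeries.coeff N) H
    simp only [PowerSeries.coeff_mul, PowerSeries.coeff_rescale, pochSeries,
      PowerSeries.coeff_mk] at h
    trans (∑ p ∈ antidiagonal N, mittagLeffler p.1 σ *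
      ((ε : ℂ) ^ p.2 * (poch (-ν) p.2 / (p.2.factorial : ℂ)))) *
        ((poch (μ - ν) N * (Complex.Gamma (1 + μ + (N : ℂ)))⁻¹) * (y : ℂ) ^ N)
    · rw [sum_mul]
      refine sum_congr rfl fun p hp => ?_
      rw [hf_def, ← HasAntidiagonal.mem_antidiagonal.1 hp]
      ring
    · rw [h]
      push_cast
      ring
  · have h := (hasSum_regularizedGaussHGFun (-ν) (μ + n - ν) (1 + (μ + n)) hn1).mul_left
      (poch (μ - ν) n * mittagLeffler n σ * (y : ℂ) ^ n)
    rw [mul_assoc _ ((y : ℂ) ^ n)] at h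
    convert! h using 2 with k
    rw [hf_def]
    simp only
    rw [poch_add, pow_add, show μ + n - ν = μ - ν + n by ring,
      show 1 + μ + ((n + k : ℕ) : ℂ) = 1 + (μ + n) + k by push_cast; ring]
    push_cast
    ring

theorem mk_mittagLeffler_mul_pochSeries (ν : ℂ) :
    PowerSeries.mk (fun n => mittagLeffler n ν) * PowerSeries.rescale (1 : ℂ) (pochSeries (-ν)) =
      PowerSeries.rescale (-1 : ℂ) (pochSeries (-ν)) := by
  have h : pochSeries ν * pochSeries (-ν) = 1 := by
    rw [pochSeries_mul, add_neg_cancel, pochSeries_zero]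
  rw [mk_mittagLeffler, PowerSeries.rescale_one, RingHom.id_apply, mul_right_comm, h, one_mul]

theorem mk_mittagLeffler_neg_mul_pochSeries (ν : ℂ) :
    PowerSeries.mk (fun n => mittagLeffler n (-ν)) *
      PowerSeries.rescale (-1 : ℂ) (pochSeries (-ν)) =
      PowerSeries.rescale (1 : ℂ) (pochSeries (-ν)) := by
  have h : pochSeries ν * pochSeries (-ν) = 1 := by
    rw [pochSeries_mul, add_neg_cancel, pochSeries_zero]
  rw [mk_mittagLeffler, neg_neg, PowerSeries.rescale_one, RingHom.id_apply, mul_assoc, ← map_mul, h,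
    map_one, mul_one]

theorem mk_mittagLeffler_mul_neg (σ : ℂ) :
    PowerSeries.mk (fun n => mittagLeffler n σ) * PowerSeries.mk (fun n => mittagLeffler n (-σ)) =
      1 := by
  have h : pochSeries σ * pochSeries (-σ) = 1 := by
    rw [pochSeries_mul, add_neg_cancel, pochSeries_zero]
  rw [mk_mittagLeffler, mk_mittagLeffler, neg_neg, mul_mul_mul_comm, h, ← map_mul, mul_comm, mul_comm
    (pochSeries _), h, map_one, mul_one]

-- The Pochhammer factors combine to (μ-ν)_N and the powers to y^{N/2}, leaving a coefficient of G_σ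
-- G_{-σ} = 1.
open Finset in
theorem sum_seriesCoeff_mul (ν σ μ : ℂ) {x : ℝ} (hx : 0 < (1 - x) / (1 + x)) (N : ℕ) :
    ∑ n ∈ range (N + 1), seriesCoeff ν σ μ x n * seriesCoeff ν (-σ) (μ + (n : ℂ)) x (N - n) =
      if N = 0 then 1 else 0 := by
  have h := congrArg (PowerSeries.coeff N) (mk_mittagLeffler_mul_neg σ)
  simp only [PowerSeries.coeff_mul, PowerSeries.coeff_mk, PowerSeries.coeff_one] at h
  rw [← Nat.sum_antidiagonal_eq_sum_range_succ fun n k =>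
    seriesCoeff ν σ μ x n * seriesCoeff ν (-σ) (μ + (n : ℂ)) x k]
  trans (∑ p ∈ antidiagonal N, mittagLeffler p.1 σ * mittagLeffler p.2 (-σ)) *
    (poch (μ - ν) N * ((((1 - x) / (1 + x)) ^ ((N : ℝ) / 2) : ℝ) : ℂ))
  · rw [sum_mul]
    refine sum_congr rfl fun p hp => ?_
    rw [← HasAntidiagonal.mem_antidiagonal.1 hp, seriesCoeff, seriesCoeff, poch_add, Nat.cast_add,
      add_div, Real.rpow_add hx, show μ - ν + p.1 = μ + p.1 - ν by ring]
    push_cast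
    ring
  · rw [h]
    split_ifs with hN
    · simp [hN, poch_zero]
    · simp

/-- `HasSum` is unconditional, which in ℂ means absolute convergence. -/
theorem theorem5 (x : ℝ) (hx : x ∈ Set.Ioo (0 : ℝ) 1) (μ ν : ℂ) :
    HasSum (fun n : ℕ => seriesCoeff ν ν μ x n * legendreP ν (-(n : ℂ) - μ) (1 / x))
      (legendreP ν (-μ) x / (x : ℂ) ^ ν) ∧
    HasSum (fun n : ℕ => seriesCoeff ν (-ν) μ x n * (legendreP ν (-(n : ℂ) - μ) x / (x : ℂ) ^ ν))
      (legendreP ν (-μ) (1 / x)) ∧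
    (∀ N : ℕ, ∑ n ∈ Finset.range (N + 1),
      seriesCoeff ν ν μ x n * seriesCoeff ν (-ν) (μ + (n : ℂ)) x (N - n) =
        if N = 0 then 1 else 0) ∧
    (∀ N : ℕ, ∑ n ∈ Finset.range (N + 1),
      seriesCoeff ν (-ν) μ x n * seriesCoeff ν ν (μ + (n : ℂ)) x (N - n) =
        if N = 0 then 1 else 0) := by
  obtain ⟨hx0, hx1⟩ := hx
  have h1x : 0 < 1 + x := by linarith
  set y : ℝ := (1 - x) / (1 + x) with hy
  have hy0 : 0 < y := div_pos (by linarith) h1x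
  have hy1 : y < 1 := by rw [hy, div_lt_one h1x]; linarith
  -- Common prefactor: ((1+x)/2)^ν / x^ν at x equals ((1+1/x)/2)^ν at 1/x.
  set K : ℂ := (((1 + x) / (2 * x) : ℝ) : ℂ) ^ ν with hK
  have hP (m : ℂ) : legendreP ν (-m) x / (x : ℂ) ^ ν = (y : ℂ) ^ (m / 2) * (K *
      Complex.regularizedGaussHGFun (-ν) (m - ν) (1 + m) ((-1 * y : ℝ) : ℂ)) := by
    have hxν : (x : ℂ) ^ ν ≠ 0 := by
      simp [Complex.cpow_eq_zero_iff, hx0.ne']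
    rw [legendreP_neg ν m hx0, ← hy, abs_of_pos hy0,
      show (x - 1) / (x + 1) = -1 * y by rw [hy]; ring,
      show (1 + x) / 2 = (1 + x) / (2 * x) * x by field_simp, Complex.ofReal_mul,
      Complex.mul_cpow_ofReal_nonneg (by positivity) hx0.le, ← hK]
    field_simp
  have hQ (m : ℂ) : legendreP ν (-m) (1 / x) = (y : ℂ) ^ (m / 2) * (K *
      Complex.regularizedGaussHGFun (-ν) (m - ν) (1 + m) ((1 * y : ℝ) : ℂ)) := by
    have e1 : (1 / x - 1) / (1 / x + 1) = 1 * y := by rw [hy]; field_simp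
    have e2 : (1 - 1 / x) / (1 + 1 / x) = -y := by
      rw [hy]; field_simp; ring
    rw [legendreP_neg ν m (by positivity), e1, e2, abs_neg, abs_of_pos hy0,
      show (1 + 1 / x) / 2 = (1 + x) / (2 * x) by field_simp; ring, ← hK]
  have hterm (n : ℕ) : ((y ^ ((n : ℝ) / 2) : ℝ) : ℂ) * (y : ℂ) ^ ((μ + n) / 2) =
      (y : ℂ) ^ (μ / 2) * (y : ℂ) ^ n := by
    have hyc : (y : ℂ) ≠ 0 := by exact_mod_cast hy0.ne'
    rw [Complex.ofReal_cpow hy0.le, ← Complex.cpow_add _ _ hyc, ← Complex.cpow_natCast,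
      ← Complex.cpow_add _ _ hyc]
    congr 1
    push_cast
    ring
  have hneg (n : ℕ) : -(n : ℂ) - μ = -(μ + n) := by ring
  refine ⟨?_, ?_, sum_seriesCoeff_mul ν ν μ hy0, fun N => ?_⟩
  · have h := (hasSum_regularizedGaussHGFun_neg μ ν ν 1 (by simp)
      (by simpa using mk_mittagLeffler_mul_pochSeries ν) hy0.le hy1).mul_left
      ((y : ℂ) ^ (μ / 2) * K)
    rw [hP, ← mul_assoc]
    convert! h using 2 with n
    rw [hneg, hQ, seriesCoeff, ← hy]
    linear_combination poch (μ - ν) n * mittagLeffler n ν * K *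
      Complex.regularizedGaussHGFun (-ν) (μ + n - ν) (1 + (μ + n)) ((1 * y : ℝ) : ℂ) * hterm n
  · have h := (hasSum_regularizedGaussHGFun_neg μ ν (-ν) (-1) (by simp)
      (by simpa using mk_mittagLeffler_neg_mul_pochSeries ν) hy0.le hy1).mul_left
      ((y : ℂ) ^ (μ / 2) * K)
    rw [hQ, ← mul_assoc, ← neg_neg (1 : ℝ)]
    convert! h using 2 with n
    rw [hneg, hP, seriesCoeff, ← hy]
    linear_combination poch (μ - ν) n * mittagLeffler n (-ν) * K *
      Complex.regularizedGaussHGFun (-ν) (μ + n - ν) (1 + (μ + n)) ((-1 * y : ℝ) : ℂ) * hterm n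
  · have h := sum_seriesCoeff_mul ν (-ν) μ hy0 N
    rwa [neg_neg] at h
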